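/- Let $l\ge 2$ be an integer, $I\subseteq\mathbb R$ a nonempty open interval, $f:I\to(0,\infty)$ a smooth function, and $(F,g_F)$ a nonempty smooth (pseudo-)Riemannian manifold of dimension $l$. Let $M=I\times F$ with the metric $g=-dt^2+f(t)^2g_F$, let $P=\partial/\partial t$ and $\pi(Y)=g(Y,P)$, and let $\lambda_1,\lambda_2$ be nonzero real numbers. Let $\nabla$ be the Levi-Civita connection of $g$ and let $\overline\nabla$ be the quarter-symmetric connection $$\overline\nabla_XY=\nabla_XY+\lambda_1\pi(Y)X-\lambda_2\,g(X,Y)P .$$ For any affine connection $D$ put $R(X,Y)=D_XD_Y-D_YD_X-D_{[X,Y]}$ and let $\mathrm{Ric}(X,Y)$ be the trace of $Z\mapsto R(X,Z)Y$, that is, $\sum_k\varepsilon_k\langle R(X,E_k)Y,E_k\rangle$ for an orthonormal basis $(E_k)$ with $\langle E_k,E_k\rangle=\varepsilon_k=\pm1$ (with this sign the unit $n$-sphere has $\mathrm{Ric}=-(n-1)g$). A manifold with a metric $g$ and a connection is called Einstein with the Einstein constant $\alpha\in\mathbb R$ if $\mathrm{Ric}=\alpha g$. Then, for $\alpha\in\mathbb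 R$, $(M,\overline\nabla)$ is Einstein with the Einstein constant $\alpha$ if and only if there is a real number $\alpha_F$ such that $(F,\nabla^F)$, with $\nabla^F$ the Levi-Civita connection of $g_F$, is Einstein with the Einstein constant $\alpha_F$, and one of the following holds for some real constants $c_0,c_1,c_2$ and all $t\in I$: 1. $\alpha=(\lambda_1^2-\lambda_1\lambda_2)\,l$, $\ \alpha_F=c_2^2(l\lambda_1^2-\lambda_2^2)$, $\ f(t)=c_2$; 2. $\lambda_1=\lambda_2$, $\ \alpha=0$, $\ \alpha_F=(l-1)c_2^2\lambda_1^2$, $\ f(t)=c_1e^{\lambda_1t}+c_2$; 3. $\lambda_2^2-2l\lambda_1^2+l\lambda_1\lambda_2\ne0$, $\ \lambda_2\ne l\lambda_1$, $\ \alpha=\dfrac{(3l^2+l)\lambda_1^2\lambda_2^2-(l^2+l)\lambda_1\lambda_2^3-2l^2\lambda_1^3\lambda_2}{(l\lambda_1-\lambda_2)^2}$, $\ \alpha_F=0$, $\ f(t)=c_0\,e^{(l\lambda_1^2-\lambda_2^2)t/(l\lambda_1-\lambda_2)}$; 4. $\lambda_2^2-2l\lambda_1^2+l\lambda_1\lambda_2=0$,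 $\ \alpha=l\left(\lambda_1-\tfrac12\lambda_2\right)^2$, $\ \alpha_F=0$, $\ f(t)=c_1e^{\lambda_2t/2}$. -/

import Mathlib

set_option maxSynthPendingDepth 3

open scoped Manifold ContDiff

noncomputable section

namespace QuarterSym

/-! ### Affine connections in coordinates

A metric in coordinates is a map `G : E → (E →L[ℝ] E →L[ℝ] ℝ)` and an affine connection is given by
its coefficients `Γ : E → (E →L[ℝ] E →L[ℝ] E)`: in the chart,
`(∇_X Y)(y) = (DY)(y)(X y) + Γ y (X y) (Y y)`, so `Γ y u v` is `∇_u v` for constant fields. -/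

section Coordinates

variable {E : Type*} [NormedAddCommGroup E] [NormedSpace ℝ E]

/-- The coefficients (Christoffel symbols) of the Levi-Civita connection of `G`:
`2 G(Γ(u, v), w) = (D_u G)(v, w) + (D_v G)(u, w) - (D_w G)(u, v)`. -/
def christoffel (G : E → E →L[ℝ] E →L[ℝ] ℝ) (y : E) : E →L[ℝ] E →L[ℝ] E :=
  (ContinuousLinearMap.compL ℝ E (E →L[ℝ] ℝ) E (G y).inverse).comp
    ((1 / 2 : ℝ) • (fderiv ℝ G y + (fderiv ℝ G y).flip -
      (ContinuousLinearMap.flipₗᵢ ℝ E E ℝ).toContinuousLinearEquiv.toContinuousLinearMap.comp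
        (fderiv ℝ G y).flip))

theorem christoffel_apply (G : E → E →L[ℝ] E →L[ℝ] ℝ) (y u v : E) :
    christoffel G y u v = (G y).inverse ((1 / 2 : ℝ) •
      (fderiv ℝ G y u v + fderiv ℝ G y v u - ((fderiv ℝ G y).flip u).flip v)) := by
  rfl

/-- The coefficients of the connection
`∇̄_X Y = ∇_X Y + a π(Y) X - b G(X, Y) P`, where `π(Y) = G(Y, P)`. -/
def quarterSymmCoeff (G : E → E →L[ℝ] E →L[ℝ] ℝ) (P : E → E) (a b : ℝ) (y : E) :
    E →L[ℝ] E →L[ℝ] E :=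
  christoffel G y + a • ContinuousLinearMap.smulRightL ℝ E E ((G y).flip (P y))
    - b • ((ContinuousLinearMap.smulRightL ℝ E E).flip (P y)).comp (G y)

theorem quarterSymmCoeff_apply (G : E → E →L[ℝ] E →L[ℝ] ℝ) (P : E → E) (a b : ℝ) (y u v : E) :
    quarterSymmCoeff G P a b y u v =
      christoffel G y u v + (a * G y v (P y)) • u - (b * G y u v) • P y := by
  simp [quarterSymmCoeff, mul_smul]

/-- The linear map `w ↦ R(u, w) v`, where `R(X, Y) = ∇_X ∇_Y - ∇_Y ∇_X - ∇_{[X, Y]}`. -/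
def curvature (Γ : E → E →L[ℝ] E →L[ℝ] E) (y u v : E) : E →L[ℝ] E :=
  (fderiv ℝ Γ y u).flip v - ((fderiv ℝ Γ y).flip u).flip v
    + (Γ y u).comp ((Γ y).flip v) - (Γ y).flip (Γ y u v)

theorem curvature_apply (Γ : E → E →L[ℝ] E →L[ℝ] E) (y u v w : E) :
    curvature Γ y u v w =
      fderiv ℝ Γ y u w v - fderiv ℝ Γ y w u v + Γ y u (Γ y w v) - Γ y w (Γ y u v) := by
  rfl

/-- The Ricci tensor `Ric(u, v) = ∑ₖ εₖ ⟨R(u, Eₖ) v, Eₖ⟩` (`Eₖ` an orthonormal basis), that is, the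
trace of `w ↦ R(u, w) v`. With this sign convention the unit `n`-sphere has `Ric = -(n - 1) g`. -/
def ricci (Γ : E → E →L[ℝ] E →L[ℝ] E) (y u v : E) : ℝ :=
  LinearMap.trace ℝ E (curvature Γ y u v : E →ₗ[ℝ] E)

end Coordinates

/-! ### Metrics and connections on a manifold -/

section Manifold

variable {E : Type*} [NormedAddCommGroup E] [NormedSpace ℝ E] {H : Type*} [TopologicalSpace H]
  (J : ModelWithCorners ℝ E H) {M : Type*} [TopologicalSpace M] [ChartedSpace H M]

variable (M) in
/-- Fields of bilinear forms on the tangent spaces of `M`. -/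
abbrev BilinField : Type _ :=
  ∀ x : M, TangentSpace J x →L[ℝ] TangentSpace J x →L[ℝ] ℝ

/-- `g` is a (smooth) pseudo-Riemannian metric. -/
structure IsPseudoRiemannian [IsManifold J ∞ M] (g : BilinField J M) : Prop where
  symm : ∀ x v w, g x v w = g x w v
  nondegenerate : ∀ x v, (∀ w, g x v w = 0) → v = 0
  contMDiff : ContMDiff J (J.prod 𝓘(ℝ, E →L[ℝ] E →L[ℝ] ℝ)) ∞
    (fun x ↦ Bundle.TotalSpace.mk' (E →L[ℝ] E →L[ℝ] ℝ)
      (E := fun x : M ↦ TangentSpace J x →L[ℝ] TangentSpace J x →L[ℝ] ℝ) x (g x))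

/-- The expression of `g` in the chart `e`: the pullback of `g` under the inverse of `e`. -/
def chartMetric (g : BilinField J M) (e : OpenPartialHomeomorph M H) (y : E) :
    E →L[ℝ] E →L[ℝ] ℝ :=
  let B : E →L[ℝ] E →L[ℝ] ℝ := g ((e.extend J).symm y)
  let φ : E →L[ℝ] E := mfderiv 𝓘(ℝ, E) J (e.extend J).symm y
  B.bilinearComp φ φ

variable (M) in
/-- Affine connections on `M`, given by their coefficients in every chart. -/
abbrev ConnCoeffs : Type _ :=
  OpenPartialHomeomorph M H → E → E →L[ℝ] E →L[ℝ] E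

/-- The Levi-Civita connection of `g`. -/
def leviCivita (g : BilinField J M) : ConnCoeffs (E := E) (H := H) M :=
  fun e ↦ christoffel (chartMetric J g e)

/-- The connection `∇̄_X Y = ∇_X Y + a π(Y) X - b g(X, Y) P`, where `∇` is the Levi-Civita
connection of `g` and `π(Y) = g(Y, P)`. -/
def quarterSymm (g : BilinField J M) (P : ∀ x : M, TangentSpace J x) (a b : ℝ) :
    ConnCoeffs (E := E) (H := H) M :=
  fun e ↦ quarterSymmCoeff (chartMetric J g e)
    (VectorField.mpullback 𝓘(ℝ, E) J (e.extend J).symm P) a b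

theorem chartMetric_apply (g : BilinField J M) (e : OpenPartialHomeomorph M H) (y u v : E) :
    chartMetric J g e y u v = g ((e.extend J).symm y)
      (mfderiv 𝓘(ℝ, E) J (e.extend J).symm y u) (mfderiv 𝓘(ℝ, E) J (e.extend J).symm y v) := by
  rfl

/-- `Ric = α g` for the Ricci tensor of the connection `C`, in every chart of the atlas. -/
def IsEinstein (g : BilinField J M) (C : ConnCoeffs (E := E) (H := H) M) (α : ℝ) : Prop :=
  ∀ e ∈ atlas H M, ∀ y ∈ (e.extend J).target, ∀ u v : E,
    ricci (C e) y u v = α * chartMetric J g e y u v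

end Manifold

/-! ### The product `I × F` with the metric `-dt² + f(t)² g_F` -/

section Warped

variable {E : Type*} [NormedAddCommGroup E] [NormedSpace ℝ E] {H : Type*} [TopologicalSpace H]
  (J : ModelWithCorners ℝ E H) {F : Type*} [TopologicalSpace F] [ChartedSpace H F]
  (I : TopologicalSpace.Opens ℝ)

/-- The one-form `dt` on `I × F`. -/
def dt (p : I × F) : TangentSpace (𝓘(ℝ, ℝ).prod J) p →L[ℝ] ℝ :=
  mfderiv (𝓘(ℝ, ℝ).prod J) 𝓘(ℝ, ℝ) (fun q : I × F ↦ (q.1 : ℝ)) p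

/-- The derivative of the projection `I × F → F`. -/
def dprojF (p : I × F) : TangentSpace (𝓘(ℝ, ℝ).prod J) p →L[ℝ] TangentSpace J p.2 :=
  mfderiv (𝓘(ℝ, ℝ).prod J) J (Prod.snd : I × F → F) p

/-- The metric `-dt² + f(t)² g_F` on `I × F`. -/
def warpedMetric (f : ℝ → ℝ) (gF : BilinField J F) : BilinField (𝓘(ℝ, ℝ).prod J) (I × F) :=
  fun p ↦
    let B : E →L[ℝ] E →L[ℝ] ℝ := gF p.2
    let τ : ℝ × E →L[ℝ] ℝ := dt J I p
    let σ : ℝ × E →L[ℝ] E := dprojF J I p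
    (-(ContinuousLinearMap.mul ℝ ℝ).bilinearComp τ τ + (f p.1) ^ 2 • B.bilinearComp σ σ :
      ℝ × E →L[ℝ] ℝ × E →L[ℝ] ℝ)

theorem warpedMetric_apply (f : ℝ → ℝ) (gF : BilinField J F) (p : I × F)
    (v w : TangentSpace (𝓘(ℝ, ℝ).prod J) p) :
    warpedMetric J I f gF p v w =
      -(dt J I p v * dt J I p w) + f p.1 ^ 2 * gF p.2 (dprojF J I p v) (dprojF J I p w) := by
  rfl

/-- The vector field `∂/∂t` on `I × F`. -/
def partialT (p : I × F) : TangentSpace (𝓘(ℝ, ℝ).prod J) p :=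
  ((1 : ℝ), (0 : E))

theorem dprojF_partialT (p : I × F) : dprojF J I p (partialT J I p) = 0 := by
  simp only [dprojF, mfderiv_snd]
  rfl

theorem dt_apply (p : I × F) (v : TangentSpace (𝓘(ℝ, ℝ).prod J) p) :
    dt J I p v = (show ℝ × E from v).1 := by
  have h1 : HasMFDerivAt 𝓘(ℝ, ℝ) 𝓘(ℝ, ℝ) (Subtype.val : I → ℝ) p.1
      (ContinuousLinearMap.id ℝ ℝ) := by
    refine ⟨continuous_subtype_val.continuousAt, ?_⟩
    have : Nonempty I := ⟨p.1⟩
    refine (hasFDerivWithinAt_id _ _).congr_of_eventuallyEq ?_ ?_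
    · have hm : (I : Set ℝ) ∈ nhds (p.1 : ℝ) := I.2.mem_nhds p.1.2
      refine Filter.mem_of_superset (mem_nhdsWithin_of_mem_nhds hm) ?_
      intro y hy
      have := (I.openPartialHomeomorphSubtypeCoe ⟨p.1⟩).right_inv (x := y) (by simpa using hy)
      simpa [writtenInExtChartAt, extChartAt, TopologicalSpace.Opens.chartAt_eq,
        OpenPartialHomeomorph.subtypeRestr, chartAt_self_eq] using this
    · simp [writtenInExtChartAt, extChartAt, TopologicalSpace.Opens.chartAt_eq,
        OpenPartialHomeomorph.subtypeRestr, chartAt_self_eq]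
      exact (I.openPartialHomeomorphSubtypeCoe ⟨p.1⟩).left_inv (x := p.1) (by simp)
  have h2 := h1.comp p (hasMFDerivAt_fst (I := 𝓘(ℝ, ℝ)) (I' := J) p)
  have h3 : dt J I p = _ := h2.mfderiv
  rw [h3]
  rfl

theorem dt_partialT (p : I × F) : dt J I p (partialT J I p) = 1 :=
  dt_apply J I p _

end Warped

end QuarterSym

end

/-! In a product chart the metric is `-dt² + f² h`, with `h` the chart expression of `g_F`. Write
`a`, `b` for `λ₁`, `λ₂`, `n` for the dimension of the fibre, and put `H = f'/f`, `S = f f' - b f²`.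
The Ricci tensor of the quarter-symmetric connection has no mixed time-fibre terms: it is a multiple
of `dt²` plus the Ricci tensor of `h` plus a function of `t` times `h` (`ricci_coeff`). Hence the
Einstein condition splits into a linear equation `f'' = b f' + m f` with `m = a² - a b - α/n`, and
the requirement that at each time the fibre be Einstein with a constant computed from `f`. As `h` is
nondegenerate, that constant cannot depend on `t`; this is the second scalar equation
(`isEinstein_warpedMetric_iff_exists`).

Eliminating `f''` makes the second equation a conserved quadratic form in `(f', f)`. Its derivative,
with `f''` eliminated again, is a homogeneous quadratic relation between `f'` and `f`
(`WarpingEquations.quadratic`). If `a ≠ b`, the continuous function `f'/f` is a root of a fixed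
quadratic on an interval, so it is a constant `k` and `f = c e^{kt}`. If `a = b`, the relation
forces `α = 0`, so `f'' = a f'` and `f = c e^{at} + d` (`exists_eq_of_warpingEquations`).
Substituting back determines `k`, `α` and `α_F` (`forall_warpingEquations_iff`). -/

noncomputable section

namespace QuarterSym

/-! ### Connections, curvature and traces in a vector space -/

section Coordinates

variable {E : Type*} [NormedAddCommGroup E] [NormedSpace ℝ E]

/-- The form is an injective map from `E` to its dual, which has the same dimension. Invertibility
matters because `ContinuousLinearMap.inverse` is zero on non-invertible maps, so `christoffel` has
its meaning only here. -/
theorem isInvertible_of_nondegenerate [FiniteDimensional ℝ E] (B : E →L[ℝ] E →L[ℝ] ℝ)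
    (hB : ∀ v, (∀ w, B v w = 0) → v = 0) : B.IsInvertible := by
  have hinj : Function.Injective (B : E →ₗ[ℝ] (E →L[ℝ] ℝ)) := by
    rw [← LinearMap.ker_eq_bot, LinearMap.ker_eq_bot']
    intro v hv
    exact hB v fun w ↦ by
      have : B v = 0 := hv
      simp [this]
  have hdim : Module.finrank ℝ E = Module.finrank ℝ (E →L[ℝ] ℝ) := by
    rw [← (LinearMap.toContinuousLinearMap : (E →ₗ[ℝ] ℝ) ≃ₗ[ℝ] (E →L[ℝ] ℝ)).finrank_eq]
    exact (Subspace.dual_finrank_eq (K := ℝ) (V := E)).symm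
  refine ⟨(LinearEquiv.ofInjectiveOfFinrankEq (B : E →ₗ[ℝ] (E →L[ℝ] ℝ)) hinj
    hdim).toContinuousLinearEquiv, ?_⟩
  ext v w
  rfl

theorem fderiv_apply_apply {E' F' : Type*} [NormedAddCommGroup E'] [NormedSpace ℝ E']
    [NormedAddCommGroup F'] [NormedSpace ℝ F'] {Γ : E → E' →L[ℝ] E' →L[ℝ] F'} {y : E}
    (hΓ : DifferentiableAt ℝ Γ y) (p : E) (q r : E') :
    fderiv ℝ Γ y p q r = fderiv ℝ (fun z ↦ Γ z q r) y p := by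
  have h1 : HasFDerivAt (fun z ↦ Γ z q) ((fderiv ℝ Γ y).flip q) y := by
    simpa using hΓ.hasFDerivAt.clm_apply (hasFDerivAt_const q y)
  have h2 : HasFDerivAt (fun z ↦ Γ z q r) (((fderiv ℝ Γ y).flip q).flip r) y := by
    simpa using h1.clm_apply (hasFDerivAt_const r y)
  rw [h2.fderiv]
  rfl

/-- The characterisation of the Levi-Civita connection by the Koszul formula. -/
theorem metric_christoffel {G : E → E →L[ℝ] E →L[ℝ] ℝ} {y : E} (hG : (G y).IsInvertible)
    (u v w : E) : G y (christoffel G y u v) w =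
      (1 / 2) * (fderiv ℝ G y u v w + fderiv ℝ G y v u w - fderiv ℝ G y w u v) := by
  rw [christoffel_apply, hG.self_apply_inverse]
  simp

/-- This lets Christoffel symbols be verified by the Koszul formula, without computing an inverse
metric. -/
theorem christoffel_eq_of_forall {G : E → E →L[ℝ] E →L[ℝ] ℝ} {y : E} (hG : (G y).IsInvertible)
    {u v z : E} (hz : ∀ w, G y z w =
      (1 / 2) * (fderiv ℝ G y u v w + fderiv ℝ G y v u w - fderiv ℝ G y w u v)) :
    christoffel G y u v = z := by
  apply hG.injective
  ext w
  rw [metric_christoffel hG, hz]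

theorem fderiv_metric_symm {G : E → E →L[ℝ] E →L[ℝ] ℝ} {s : Set E} (hs : IsOpen s)
    (hG : ContDiffOn ℝ ∞ G s) (hsymm : ∀ y ∈ s, ∀ u v, G y u v = G y v u) {y : E} (hy : y ∈ s)
    (p u v : E) : fderiv ℝ G y p u v = fderiv ℝ G y p v u := by
  have hd : DifferentiableAt ℝ G y :=
    (hG.contDiffAt (hs.mem_nhds hy)).differentiableAt (by simp)
  rw [fderiv_apply_apply hd, fderiv_apply_apply hd]
  congr 1
  apply Filter.EventuallyEq.fderiv_eq
  filter_upwards [hs.mem_nhds hy] with z hz using hsymm z hz u v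

theorem christoffel_symm {G : E → E →L[ℝ] E →L[ℝ] ℝ} {s : Set E} (hs : IsOpen s)
    (hG : ContDiffOn ℝ ∞ G s) (hsymm : ∀ y ∈ s, ∀ u v, G y u v = G y v u) {y : E} (hy : y ∈ s)
    (u v : E) : christoffel G y u v = christoffel G y v u := by
  rw [christoffel_apply, christoffel_apply]
  congr 2
  ext w
  simp [fderiv_metric_symm hs hG hsymm hy w u v, add_comm]

theorem contDiffOn_christoffel [FiniteDimensional ℝ E] {G : E → E →L[ℝ] E →L[ℝ] ℝ} {s : Set E}
    (hs : IsOpen s) (hG : ContDiffOn ℝ ∞ G s) (hinv : ∀ y ∈ s, (G y).IsInvertible) :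
    ContDiffOn ℝ ∞ (christoffel G) s := by
  have : CompleteSpace E := FiniteDimensional.complete ℝ E
  have hd : ContDiffOn ℝ ∞ (fderiv ℝ G) s := hG.fderiv_of_isOpen hs (by simp)
  rw [contDiffOn_clm_apply]
  intro u
  rw [contDiffOn_clm_apply]
  intro v
  simp only [christoffel_apply]
  have hi : ContDiffOn ℝ ∞ (fun y ↦ (G y).inverse) s := fun y hy ↦
    ((hinv y hy).contDiffAt_map_inverse).comp_contDiffWithinAt y (hG y hy)
  have happ : ∀ p q r : E, ContDiffOn ℝ ∞ (fun y ↦ fderiv ℝ G y p q r) s := fun p q r ↦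
    ((hd.clm_apply contDiffOn_const).clm_apply contDiffOn_const).clm_apply contDiffOn_const
  refine hi.clm_apply (contDiffOn_clm_apply.2 fun w ↦ ?_)
  have := contDiffOn_const (c := (1 / 2 : ℝ)) |>.mul
    (((happ u v w).add (happ v u w)).sub (happ w u v))
  simpa using this

theorem contDiffOn_quarterSymmCoeff [FiniteDimensional ℝ E] {G : E → E →L[ℝ] E →L[ℝ] ℝ}
    {s : Set E} (hs : IsOpen s) (hG : ContDiffOn ℝ ∞ G s) (hinv : ∀ y ∈ s, (G y).IsInvertible)
    {P : E → E} (hP : ContDiffOn ℝ ∞ P s) (a b : ℝ) :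
    ContDiffOn ℝ ∞ (quarterSymmCoeff G P a b) s := by
  have hΓ := contDiffOn_christoffel hs hG hinv
  rw [contDiffOn_clm_apply]
  intro u
  rw [contDiffOn_clm_apply]
  intro v
  simp only [quarterSymmCoeff_apply]
  have h1 : ContDiffOn ℝ ∞ (fun y ↦ christoffel G y u v) s :=
    (hΓ.clm_apply contDiffOn_const).clm_apply contDiffOn_const
  have h2 : ContDiffOn ℝ ∞ (fun y ↦ G y v (P y)) s :=
    (hG.clm_apply contDiffOn_const).clm_apply hP
  have h3 : ContDiffOn ℝ ∞ (fun y ↦ G y u v) s :=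
    (hG.clm_apply contDiffOn_const).clm_apply contDiffOn_const
  exact (h1.add ((contDiffOn_const.mul h2).smul contDiffOn_const)).sub
    ((contDiffOn_const.mul h3).smul hP)

theorem curvature_congr {Γ Γ' : E → E →L[ℝ] E →L[ℝ] E} {y : E} (h : Γ =ᶠ[nhds y] Γ') :
    curvature Γ y = curvature Γ' y := by
  funext u v
  ext w
  rw [curvature_apply, curvature_apply, h.fderiv_eq, h.eq_of_nhds]

theorem christoffel_congr {G G' : E → E →L[ℝ] E →L[ℝ] ℝ} {y : E} (h : G =ᶠ[nhds y] G') :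
    christoffel G y = christoffel G' y := by
  ext u v
  rw [christoffel_apply, christoffel_apply, h.fderiv_eq, h.eq_of_nhds]

/-- Chart expressions agree with the explicit model only on the target of the chart. Since that set
is open, germs agree, and the Ricci tensor depends only on germs. -/
theorem ricci_quarterSymmCoeff_congr {G G' : E → E →L[ℝ] E →L[ℝ] ℝ} {P P' : E → E} {s : Set E}
    (hs : IsOpen s) (hG : Set.EqOn G G' s) (hP : Set.EqOn P P' s) (a b : ℝ) {y : E} (hy : y ∈ s)
    (u v : E) :
    ricci (quarterSymmCoeff G P a b) y u v = ricci (quarterSymmCoeff G' P' a b) y u v := by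
  unfold ricci
  rw [curvature_congr]
  filter_upwards [hs.mem_nhds hy] with z hz
  ext p q
  rw [quarterSymmCoeff_apply, quarterSymmCoeff_apply, hG hz, hP hz,
    christoffel_congr (hG.eventuallyEq_of_mem (hs.mem_nhds hz))]

/-- Split `T` by its output component and use cyclicity of the trace on each summand. -/
theorem trace_prod_eq {V W : Type*} [AddCommGroup V] [Module ℝ V] [FiniteDimensional ℝ V]
    [AddCommGroup W] [Module ℝ W] [FiniteDimensional ℝ W] (T : V × W →ₗ[ℝ] V × W) :
    LinearMap.trace ℝ (V × W) T =
      LinearMap.trace ℝ V (LinearMap.fst ℝ V W ∘ₗ T ∘ₗ LinearMap.inl ℝ V W) +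
      LinearMap.trace ℝ W (LinearMap.snd ℝ V W ∘ₗ T ∘ₗ LinearMap.inr ℝ V W) := by
  have hT : T = LinearMap.inl ℝ V W ∘ₗ (LinearMap.fst ℝ V W ∘ₗ T) +
      LinearMap.inr ℝ V W ∘ₗ (LinearMap.snd ℝ V W ∘ₗ T) := by
    ext <;> simp
  conv_lhs => rw [hT]
  rw [map_add, LinearMap.trace_comp_comm', LinearMap.trace_comp_comm' (LinearMap.snd ℝ V W ∘ₗ T)]
  rfl

theorem trace_smulRight_eq [FiniteDimensional ℝ E] (φ : E →ₗ[ℝ] ℝ) (u : E) :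
    LinearMap.trace ℝ E (φ.smulRight u) = φ u := by
  have : φ.smulRight u = LinearMap.toSpanSingleton ℝ E u ∘ₗ φ := by
    ext; simp
  rw [this, LinearMap.trace_comp_comm',
    LinearMap.trace_eq_matrix_trace ℝ (Module.Basis.singleton Unit ℝ)]
  simp [Matrix.trace, LinearMap.toMatrix_apply]

end Coordinates

/-! ### Ricci tensor of the warped product in coordinates -/

section WarpedCoordinates

variable {E : Type*} [NormedAddCommGroup E] [NormedSpace ℝ E]

/-- The metric `-dt² + f(t)² h` on `ℝ × E`. -/
def warpedForm (f : ℝ → ℝ) (h : E → E →L[ℝ] E →L[ℝ] ℝ) (y : ℝ × E) :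
    ℝ × E →L[ℝ] ℝ × E →L[ℝ] ℝ :=
  -(ContinuousLinearMap.mul ℝ ℝ).bilinearComp (.fst ℝ ℝ E) (.fst ℝ ℝ E) +
    f y.1 ^ 2 • (h y.2).bilinearComp (.snd ℝ ℝ E) (.snd ℝ ℝ E)

theorem warpedForm_apply (f : ℝ → ℝ) (h : E → E →L[ℝ] E →L[ℝ] ℝ) (y u v : ℝ × E) :
    warpedForm f h y u v = -(u.1 * v.1) + f y.1 ^ 2 * h y.2 u.2 v.2 := by
  simp [warpedForm]

/-- A smooth positive function on an open set of times and a smooth family of nondegenerate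
symmetric forms on an open set of `E`. -/
structure IsWarpedData (f : ℝ → ℝ) (h : E → E →L[ℝ] E →L[ℝ] ℝ) (s : Set ℝ) (U : Set E) :
    Prop where
  isOpen_time : IsOpen s
  isOpen_space : IsOpen U
  smooth_fun : ContDiffOn ℝ ∞ f s
  pos : ∀ t ∈ s, 0 < f t
  smooth_form : ContDiffOn ℝ ∞ h U
  symm : ∀ x ∈ U, ∀ u v, h x u v = h x v u
  nondegenerate : ∀ x ∈ U, ∀ v, (∀ w, h x v w = 0) → v = 0

namespace IsWarpedData

variable {f : ℝ → ℝ} {h : E → E →L[ℝ] E →L[ℝ] ℝ} {s : Set ℝ} {U : Set E}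

theorem hasDerivAt (hw : IsWarpedData f h s U) {t : ℝ} (ht : t ∈ s) :
    HasDerivAt f (deriv f t) t :=
  ((hw.smooth_fun.contDiffAt (hw.isOpen_time.mem_nhds ht)).differentiableAt (by simp)).hasDerivAt

theorem hasDerivAt_deriv (hw : IsWarpedData f h s U) {t : ℝ} (ht : t ∈ s) :
    HasDerivAt (deriv f) (deriv (deriv f) t) t :=
  (((hw.smooth_fun.deriv_of_isOpen (m := ∞) hw.isOpen_time (by simp)).contDiffAt
    (hw.isOpen_time.mem_nhds ht)).differentiableAt (by simp)).hasDerivAt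

theorem differentiableAt_form (hw : IsWarpedData f h s U) {x : E} (hx : x ∈ U) :
    DifferentiableAt ℝ h x :=
  (hw.smooth_form.contDiffAt (hw.isOpen_space.mem_nhds hx)).differentiableAt (by simp)

theorem isInvertible_form [FiniteDimensional ℝ E] (hw : IsWarpedData f h s U) {x : E}
    (hx : x ∈ U) : (h x).IsInvertible :=
  isInvertible_of_nondegenerate _ (hw.nondegenerate x hx)

theorem isOpen_prod (hw : IsWarpedData f h s U) : IsOpen (s ×ˢ U) :=
  hw.isOpen_time.prod hw.isOpen_space

theorem isInvertible [FiniteDimensional ℝ E] (hw : IsWarpedData f h s U) {y : ℝ × E}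
    (hy : y ∈ s ×ˢ U) : (warpedForm f h y).IsInvertible := by
  refine isInvertible_of_nondegenerate _ fun v hv ↦ ?_
  have h1 : v.1 = 0 := by simpa [warpedForm_apply] using hv (1, 0)
  have h2 : v.2 = 0 := by
    refine hw.nondegenerate y.2 hy.2 _ fun w ↦ ?_
    simpa [warpedForm_apply, (hw.pos y.1 hy.1).ne'] using hv (0, w)
  exact Prod.ext h1 h2

theorem contDiffOn [FiniteDimensional ℝ E] (hw : IsWarpedData f h s U) :
    ContDiffOn ℝ ∞ (warpedForm f h) (s ×ˢ U) := by
  rw [contDiffOn_clm_apply]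
  intro u
  rw [contDiffOn_clm_apply]
  intro v
  simp only [warpedForm_apply]
  have hf : ContDiffOn ℝ ∞ (fun y : ℝ × E ↦ f y.1) (s ×ˢ U) :=
    hw.smooth_fun.comp contDiff_fst.contDiffOn fun y hy ↦ hy.1
  have hh : ContDiffOn ℝ ∞ (fun y : ℝ × E ↦ h y.2) (s ×ˢ U) :=
    hw.smooth_form.comp contDiff_snd.contDiffOn fun y hy ↦ hy.2
  exact contDiffOn_const.add ((hf.pow 2).mul
    ((hh.clm_apply contDiffOn_const).clm_apply contDiffOn_const))

theorem hasFDerivAt_form_apply (hw : IsWarpedData f h s U) {y : ℝ × E} (hy : y ∈ s ×ˢ U)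
    (u v : E) : HasFDerivAt (fun z : ℝ × E ↦ h z.2 u v)
      ((((fderiv ℝ h y.2).flip u).flip v).comp (.snd ℝ ℝ E)) y := by
  have h0 := (hw.differentiableAt_form hy.2).hasFDerivAt
  have h1 : HasFDerivAt (fun z ↦ h z u v) (((fderiv ℝ h y.2).flip u).flip v) y.2 := by
    simpa using (h0.clm_apply (hasFDerivAt_const u y.2)).clm_apply (hasFDerivAt_const v y.2)
  exact h1.comp y hasFDerivAt_snd

theorem hasFDerivAt_comp_fst {φ : ℝ → ℝ} {φ' : ℝ} {y : ℝ × E} (hφ : HasDerivAt φ φ' y.1) :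
    HasFDerivAt (fun z : ℝ × E ↦ φ z.1) (φ' • ContinuousLinearMap.fst ℝ ℝ E) y :=
  hφ.comp_hasFDerivAt y hasFDerivAt_fst

theorem fderiv_warpedForm [FiniteDimensional ℝ E] (hw : IsWarpedData f h s U) {y : ℝ × E}
    (hy : y ∈ s ×ˢ U) (p u v : ℝ × E) :
    fderiv ℝ (warpedForm f h) y p u v =
      2 * f y.1 * deriv f y.1 * p.1 * h y.2 u.2 v.2 +
        f y.1 ^ 2 * fderiv ℝ h y.2 p.2 u.2 v.2 := by
  have hd := (hw.contDiffOn.contDiffAt (hw.isOpen_prod.mem_nhds hy)).differentiableAt (by simp)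
  rw [fderiv_apply_apply hd]
  have h1 := ((hasFDerivAt_comp_fst (hw.hasDerivAt hy.1)).pow 2).mul
    (hw.hasFDerivAt_form_apply hy u.2 v.2)
  have h2 := (hasFDerivAt_const (-(u.1 * v.1)) y).add h1
  have h3 : (fun z ↦ warpedForm f h z u v) =
    (fun _ ↦ -(u.1 * v.1)) + (fun z : ℝ × E ↦ f z.1 ^ 2) * fun z ↦ h z.2 u.2 v.2 := by
    funext z
    simp [warpedForm_apply]
  rw [h3]
  erw [h2.fderiv]
  simp
  ring

theorem christoffel_warpedForm [FiniteDimensional ℝ E] (hw : IsWarpedData f h s U) {y : ℝ × E}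
    (hy : y ∈ s ×ˢ U) (u v : ℝ × E) :
    christoffel (warpedForm f h) y u v =
      (f y.1 * deriv f y.1 * h y.2 u.2 v.2,
        christoffel h y.2 u.2 v.2 + (deriv f y.1 / f y.1) • (u.1 • v.2 + v.1 • u.2)) := by
  have hf := (hw.pos y.1 hy.1).ne'
  refine christoffel_eq_of_forall (hw.isInvertible hy) fun w ↦ ?_
  simp only [hw.fderiv_warpedForm hy, warpedForm_apply, map_add, map_smul,
    add_apply, smul_apply, smul_eq_mul,
    metric_christoffel (hw.isInvertible_form hy.2)]
  field_simp
  ring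

/-- Here `π(v) = -v.1`, since `∂/∂t` has square `-1`. The functions of time that occur are `S = f f'
- b f²` and `H = f'/f`. -/
theorem quarterSymmCoeff_warpedForm [FiniteDimensional ℝ E] (hw : IsWarpedData f h s U)
    {y : ℝ × E} (hy : y ∈ s ×ˢ U) (a b : ℝ) (u v : ℝ × E) :
    quarterSymmCoeff (warpedForm f h) (fun _ ↦ (1, 0)) a b y u v =
      ((f y.1 * deriv f y.1 - b * f y.1 ^ 2) * h y.2 u.2 v.2 + (b - a) * (u.1 * v.1),
        christoffel h y.2 u.2 v.2 + (deriv f y.1 / f y.1) • (u.1 • v.2)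
          + (deriv f y.1 / f y.1 - a) • (v.1 • u.2)) := by
  rw [quarterSymmCoeff_apply, hw.christoffel_warpedForm hy, warpedForm_apply, warpedForm_apply]
  ext1
  · simp
    ring
  · simp
    module

theorem contDiffOn_coeff [FiniteDimensional ℝ E] (hw : IsWarpedData f h s U) (a b : ℝ) :
    ContDiffOn ℝ ∞ (quarterSymmCoeff (warpedForm f h) (fun _ ↦ (1, 0)) a b) (s ×ˢ U) :=
  contDiffOn_quarterSymmCoeff hw.isOpen_prod hw.contDiffOn (fun _ hy ↦ hw.isInvertible hy)
    contDiffOn_const a b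

theorem fderiv_coeff [FiniteDimensional ℝ E] (hw : IsWarpedData f h s U) {y : ℝ × E}
    (hy : y ∈ s ×ˢ U) (a b : ℝ) {S' H' : ℝ}
    (hS : HasDerivAt (fun t ↦ f t * deriv f t - b * f t ^ 2) S' y.1)
    (hH : HasDerivAt (fun t ↦ deriv f t / f t) H' y.1) (p u v : ℝ × E) :
    fderiv ℝ (quarterSymmCoeff (warpedForm f h) (fun _ ↦ (1, 0)) a b) y p u v =
      (S' * p.1 * h y.2 u.2 v.2 +
          (f y.1 * deriv f y.1 - b * f y.1 ^ 2) * fderiv ℝ h y.2 p.2 u.2 v.2,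
        fderiv ℝ (christoffel h) y.2 p.2 u.2 v.2 + (H' * p.1) • (u.1 • v.2 + v.1 • u.2)) := by
  have hd := ((hw.contDiffOn_coeff a b).contDiffAt
    (hw.isOpen_prod.mem_nhds hy)).differentiableAt (by simp)
  rw [fderiv_apply_apply hd]
  have hΓ : DifferentiableAt ℝ (christoffel h) y.2 :=
    ((contDiffOn_christoffel hw.isOpen_space hw.smooth_form
      (fun _ hx ↦ hw.isInvertible_form hx)).contDiffAt
      (hw.isOpen_space.mem_nhds hy.2)).differentiableAt (by simp)
  have h1 : HasFDerivAt (fun z ↦ christoffel h z u.2 v.2)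
      (((fderiv ℝ (christoffel h) y.2).flip u.2).flip v.2) y.2 := by
    simpa using (hΓ.hasFDerivAt.clm_apply (hasFDerivAt_const u.2 y.2)).clm_apply
      (hasFDerivAt_const v.2 y.2)
  have h2 := h1.comp y hasFDerivAt_snd
  have hS' := hasFDerivAt_comp_fst (E := E) hS
  have hH' := hasFDerivAt_comp_fst (E := E) hH
  have k1 := (hS'.mul (hw.hasFDerivAt_form_apply hy u.2 v.2)).add_const ((b - a) * (u.1 * v.1))
  have k2 := (h2.add (hH'.smul_const (u.1 • v.2))).add
    ((hH'.sub_const a).smul_const (v.1 • u.2))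
  have key := k1.prodMk k2
  have key' := key.congr_of_eventuallyEq
    (f₁ := fun z ↦ quarterSymmCoeff (warpedForm f h) (fun _ ↦ (1, 0)) a b z u v) (by
      filter_upwards [hw.isOpen_prod.mem_nhds hy] with z hz
      exact hw.quarterSymmCoeff_warpedForm hz a b u v)
  rw [key'.fderiv]
  ext1
  · simp
    ring
  · simp
    module

/-- With `S`, `H` and their derivatives kept as symbols, the curvature is polynomial in them. The
trace is the sum of a time block, which is a scalar, and a fibre block, which is the fibre curvature
plus a multiple of the identity plus a rank-one map. -/
theorem ricci_coeff [FiniteDimensional ℝ E] (hw : IsWarpedData f h s U) {y : ℝ × E}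
    (hy : y ∈ s ×ˢ U) (a b : ℝ) {S H S' H' : ℝ}
    (hSy : S = f y.1 * deriv f y.1 - b * f y.1 ^ 2) (hHy : H = deriv f y.1 / f y.1)
    (hS : HasDerivAt (fun t ↦ f t * deriv f t - b * f t ^ 2) S' y.1)
    (hH : HasDerivAt (fun t ↦ deriv f t / f t) H' y.1) (u v : ℝ × E) :
    ricci (quarterSymmCoeff (warpedForm f h) (fun _ ↦ (1, 0)) a b) y u v =
      ricci (christoffel h) y.2 u.2 v.2 +
        (S * H - S' - (b - a) * S - (Module.finrank ℝ E - 1) * ((H - a) * S)) * h y.2 u.2 v.2 +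
        Module.finrank ℝ E * (H' + (H - a) * (H - b + a)) * (u.1 * v.1) := by
  unfold ricci
  rw [trace_prod_eq]
  -- Vanishing torsion on the fibre cancels the terms in which `christoffel h` meets `u.2` and `w`
  -- in both orders.
  have hΓs : ∀ p q, christoffel h y.2 p q = christoffel h y.2 q p :=
    christoffel_symm hw.isOpen_space hw.smooth_form hw.symm hy.2
  have hcurv := fun w ↦ curvature_apply
    (quarterSymmCoeff (warpedForm f h) (fun _ ↦ ((1 : ℝ), (0 : E))) a b) y u v w
  simp only [hw.fderiv_coeff hy a b hS hH, hw.quarterSymmCoeff_warpedForm hy, ← hSy, ← hHy]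
    at hcurv
  have h1 : LinearMap.fst ℝ ℝ E ∘ₗ
      (curvature (quarterSymmCoeff (warpedForm f h) (fun _ ↦ (1, 0)) a b) y u v :
        ℝ × E →ₗ[ℝ] ℝ × E) ∘ₗ LinearMap.inl ℝ ℝ E =
      ((S * H - S' - (b - a) * S) * h y.2 u.2 v.2) • LinearMap.id := by
    ext
    simp [hcurv]
    ring
  -- The rank-one summand has trace `(H - a) S h(u, v)`; it lowers the factor `n` from the identity
  -- to the `n - 1` of the result.
  have h2 : LinearMap.snd ℝ ℝ E ∘ₗ
      (curvature (quarterSymmCoeff (warpedForm f h) (fun _ ↦ (1, 0)) a b) y u v :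
        ℝ × E →ₗ[ℝ] ℝ × E) ∘ₗ LinearMap.inr ℝ ℝ E =
      (curvature (christoffel h) y.2 u.2 v.2 : E →ₗ[ℝ] E) +
        ((H' + (H - a) * (H - b + a)) * (u.1 * v.1) - (H - a) * S * h y.2 u.2 v.2) •
          LinearMap.id +
        (((H - a) * S) • ((h y.2).flip v.2 : E →ₗ[ℝ] ℝ)).smulRight u.2 := by
    ext w
    simp [hcurv, curvature_apply, hΓs w u.2]
    module
  rw [h1, h2, map_add, map_add, trace_smulRight_eq, map_smul, map_smul, LinearMap.trace_id,
    LinearMap.trace_id]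
  simp
  ring

end IsWarpedData

end WarpedCoordinates

/-! ### The differential equations for the warping function -/

section WarpingFunction

/-- The two scalar equations satisfied by the warping function of an Einstein warped product. -/
structure WarpingEquations (n a b α αF : ℝ) (f : ℝ → ℝ) (t : ℝ) : Prop where
  time : α * f t = n * ((a ^ 2 - a * b) * f t + b * deriv f t - deriv (deriv f) t)
  space : αF = (1 - n) * (f t * deriv (deriv f) t - deriv f t ^ 2) +
    (b - n * a) * (f t * deriv f t) + (n * a ^ 2 - b ^ 2) * f t ^ 2

variable {s : Set ℝ} {f : ℝ → ℝ} {n a b α αF : ℝ}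

theorem deriv_eqOn (hs : IsOpen s) {g : ℝ → ℝ} (h : Set.EqOn f g s) :
    Set.EqOn (deriv f) (deriv g) s := fun _ ht ↦
  (h.eventuallyEq_of_mem (hs.mem_nhds ht)).deriv_eq

/-- The product `f(t) e^{-kt}` has zero derivative on a connected open set. -/
theorem exists_eq_exp (hs : IsOpen s) (hc : IsPreconnected s) {k : ℝ}
    (hf : ∀ t ∈ s, HasDerivAt f (k * f t) t) : ∃ c, ∀ t ∈ s, f t = c * Real.exp (k * t) := by
  have hd : ∀ t ∈ s, HasDerivAt (fun t ↦ f t * Real.exp (-(k * t))) 0 t := fun t ht ↦ by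
    have h1 : HasDerivAt (fun t ↦ -(k * t)) (-k) t := by
      simpa using (hasDerivAt_id t).const_mul k |>.fun_neg
    convert! (hf t ht).mul h1.exp using 1
    ring
  obtain ⟨c, hc⟩ := hs.exists_is_const_of_deriv_eq_zero hc
    (fun t ht ↦ (hd t ht).differentiableAt.differentiableWithinAt) (fun t ht ↦ (hd t ht).deriv)
  refine ⟨c, fun t ht ↦ ?_⟩
  rw [← hc t ht, mul_assoc, ← Real.exp_add]
  simp

/-- By Vieta every value is `u t₀` or `p - u t₀`, and a connected set of reals that is finite has at
most one point. -/
theorem exists_eq_const_of_quadratic (hc : IsPreconnected s) (hne : s.Nonempty) {u : ℝ → ℝ}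
    (hu : ContinuousOn u s) {p q : ℝ} (h : ∀ t ∈ s, u t ^ 2 - p * u t + q = 0) :
    ∃ k, ∀ t ∈ s, u t = k := by
  obtain ⟨t₀, ht₀⟩ := hne
  have hfin : (u '' s).Finite := by
    refine (Set.toFinite {u t₀, p - u t₀}).subset ?_
    rintro _ ⟨t, ht, rfl⟩
    have : (u t - u t₀) * (u t - (p - u t₀)) = 0 := by
      linear_combination h t ht - h t₀ ht₀
    rcases mul_eq_zero.1 this with h' | h'
    · exact Or.inl (sub_eq_zero.1 h')
    · exact Or.inr (sub_eq_zero.1 h')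
  have hsub : (u '' s).Subsingleton := by
    by_contra hnt
    exact (hc.image u hu).infinite_of_nontrivial (Set.not_subsingleton_iff.1 hnt) hfin
  exact ⟨u t₀, fun t ht ↦ hsub (Set.mem_image_of_mem u ht) (Set.mem_image_of_mem u ht₀)⟩

theorem hasDerivAt_mul_exp_add (c d k t : ℝ) :
    HasDerivAt (fun t ↦ c * Real.exp (k * t) + d) (c * k * Real.exp (k * t)) t := by
  have h1 : HasDerivAt (fun t ↦ k * t) k t := by
    simpa using (hasDerivAt_id t).const_mul k
  convert! (h1.exp.const_mul c).add_const d using 1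
  ring

theorem derivs_of_eq_mul_exp_add (hs : IsOpen s) {c d k : ℝ}
    (hf : ∀ t ∈ s, f t = c * Real.exp (k * t) + d) {t : ℝ} (ht : t ∈ s) :
    deriv f t = k * (f t - d) ∧ deriv (deriv f) t = k ^ 2 * (f t - d) := by
  have h1 : Set.EqOn (deriv f) (fun t ↦ c * k * Real.exp (k * t) + 0) s := fun t ht ↦ by
    rw [deriv_eqOn hs hf ht, (hasDerivAt_mul_exp_add c d k t).deriv]
    simp
  have h2 : deriv (deriv f) t = c * k * k * Real.exp (k * t) := by
    rw [deriv_eqOn hs h1 ht, (hasDerivAt_mul_exp_add (c * k) 0 k t).deriv]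
  rw [h2, h1 ht, hf t ht]
  constructor <;> ring

/-- Along a solution, `f'` and `f` satisfy a homogeneous quadratic equation. -/
theorem WarpingEquations.quadratic (hs : IsOpen s) (hn : 0 < n)
    (hf : ∀ t ∈ s, HasDerivAt f (deriv f t) t)
    (hf' : ∀ t ∈ s, HasDerivAt (deriv f) (deriv (deriv f) t) t)
    (h : ∀ t ∈ s, WarpingEquations n a b α αF f t) {t : ℝ} (ht : t ∈ s) :
    n * (b - a) * deriv f t ^ 2 + n * (a - b) * (2 * a + b) * (f t * deriv f t) +
      ((2 - n) * b - n * a) * (a ^ 2 - a * b - α / n) * f t ^ 2 = 0 := by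
  set m := a ^ 2 - a * b - α / n with hm
  have hmα : n * m = n * (a ^ 2 - a * b) - α := by rw [hm]; field_simp
  have hdd : ∀ t ∈ s, deriv (deriv f) t = b * deriv f t + m * f t := fun t ht ↦ by
    apply mul_left_cancel₀ hn.ne'
    linear_combination (h t ht).time - f t * hmα
  set B := (2 - n) * b - n * a with hB
  set C := (1 - n) * m + n * a ^ 2 - b ^ 2 with hC
  -- Inserting `f'' = b f' + m f` turns the space equation into a conserved quantity of first order,
  -- which is then differentiated.
  have hfirst : ∀ t ∈ s, αF = (n - 1) * deriv f t ^ 2 + B * (f t * deriv f t) + C * f t ^ 2 :=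
    fun t ht ↦ by
      have := (h t ht).space
      rw [hdd t ht] at this
      rw [this, hB, hC]
      ring
  have hd := (((hf' t ht).pow 2).const_mul (n - 1)).add
    (((hf t ht).mul (hf' t ht)).const_mul B) |>.add (((hf t ht).pow 2).const_mul C)
  have h0 := hd.unique ((hasDerivAt_const t αF).congr_of_eventuallyEq (by
    filter_upwards [hs.mem_nhds ht] with t ht
    simp [hfirst t ht]))
  rw [hdd t ht] at h0
  simp at h0
  rw [hB, hC] at h0
  linear_combination h0

/-- The classification of the warping functions. -/
theorem exists_eq_of_warpingEquations (hs : IsOpen s) (hc : IsPreconnected s) (hne : s.Nonempty)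
    (hn : 1 < n) (ha : a ≠ 0) (hb : b ≠ 0) (hpos : ∀ t ∈ s, 0 < f t)
    (hf : ∀ t ∈ s, HasDerivAt f (deriv f t) t)
    (hf' : ∀ t ∈ s, HasDerivAt (deriv f) (deriv (deriv f) t) t)
    (h : ∀ t ∈ s, WarpingEquations n a b α αF f t) :
    (∃ c, ∀ t ∈ s, f t = c) ∨
      (a = b ∧ α = 0 ∧ ∃ c d, ∀ t ∈ s, f t = c * Real.exp (a * t) + d) ∨
      (∃ k c, k ≠ 0 ∧ ∀ t ∈ s, f t = c * Real.exp (k * t)) := by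
  obtain ⟨t₀, ht₀⟩ := hne
  have hn0 : 0 < n := by linarith
  have hq := fun t ht ↦ WarpingEquations.quadratic hs hn0 hf hf' h (t := t) ht
  by_cases hab : a = b
  · subst hab
    right; left
    -- For `a = b` the coefficients of `f'²` and `f f'` vanish, so only the `f²` term of the
    -- quadratic relation is left.
    have hα : α = 0 := by
      have h1 := hq t₀ ht₀
      have h2 : (n - 1) * a * α * f t₀ ^ 2 = 0 := by
        field_simp at h1
        linear_combination (1 / 2) * h1
      simpa [(hpos t₀ ht₀).ne', ha, sub_ne_zero.2 hn.ne'] using h2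
    have hg : ∀ t ∈ s, HasDerivAt (deriv f) (a * deriv f t) t := fun t ht ↦ by
      convert! hf' t ht using 1
      have := (h t ht).time
      rw [hα] at this
      apply mul_left_cancel₀ hn0.ne'
      linear_combination -this
    obtain ⟨c, hc'⟩ := exists_eq_exp hs hc hg
    -- Since `f'' = a f'`, the difference `f - f'/a` is constant; its value is the additive constant
    -- `d`.
    have hd : ∀ t ∈ s, HasDerivAt (fun t ↦ f t - deriv f t / a) 0 t := fun t ht ↦ by
      convert! (hf t ht).sub ((hg t ht).div_const a) using 1
      field_simp
      ring
    obtain ⟨d, hd'⟩ := hs.exists_is_const_of_deriv_eq_zero hc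
      (fun t ht ↦ (hd t ht).differentiableAt.differentiableWithinAt)
      (fun t ht ↦ (hd t ht).deriv)
    refine ⟨rfl, hα, c / a, d, fun t ht ↦ ?_⟩
    have h1 : f t - deriv f t / a = d := hd' t ht
    rw [← h1, hc' t ht]
    ring
  · have hcont : ContinuousOn (fun t ↦ deriv f t / f t) s := fun t ht ↦
      ((hf' t ht).continuousAt.div (hf t ht).continuousAt (hpos t ht).ne').continuousWithinAt
    -- The quadratic for `f'/f` is the relation `hq` divided by `n (b - a) f²`.
    obtain ⟨k, hk⟩ := exists_eq_const_of_quadratic hc ⟨t₀, ht₀⟩ hcont (p := 2 * a + b)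
      (q := ((2 - n) * b - n * a) * (a ^ 2 - a * b - α / n) / (n * (b - a))) (fun t ht ↦ by
        have h1 := hq t ht
        have h2 : b - a ≠ 0 := sub_ne_zero.2 (Ne.symm hab)
        have h3 := (hpos t ht).ne'
        set m := a ^ 2 - a * b - α / n
        field_simp
        linear_combination h1)
    obtain ⟨c, hc'⟩ := exists_eq_exp hs hc (k := k) (fun t ht ↦ by
      convert! hf t ht using 1
      rw [← hk t ht]
      field_simp [(hpos t ht).ne'])
    rcases eq_or_ne k 0 with rfl | hk0
    · exact Or.inl ⟨c, fun t ht ↦ by simpa using hc' t ht⟩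
    · exact Or.inr (Or.inr ⟨k, c, hk0, hc'⟩)

end WarpingFunction

/-! ### Metrics read in a chart -/

section Charts

variable {E : Type*} [NormedAddCommGroup E] [NormedSpace ℝ E] {H : Type*} [TopologicalSpace H]
  {J : ModelWithCorners ℝ E H} {M : Type*} [TopologicalSpace M] [ChartedSpace H M]
  [IsManifold J ∞ M]

theorem contMDiffOn_extend_symm_target {e : OpenPartialHomeomorph M H} (he : e ∈ atlas H M) :
    ContMDiffOn 𝓘(ℝ, E) J ∞ (e.extend J).symm (e.extend J).target := by
  have h := contMDiffOn_extend_symm (I := J) (n := ∞)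
    (StructureGroupoid.subset_maximalAtlas _ he)
  rwa [J.image_eq, ← e.extend_target] at h

theorem chartMetric_symm {g : BilinField J M} (hg : IsPseudoRiemannian J g)
    (e : OpenPartialHomeomorph M H) (y u v : E) :
    chartMetric J g e y u v = chartMetric J g e y v u := by
  rw [chartMetric_apply, chartMetric_apply]
  exact hg.symm _ _ _

variable [J.Boundaryless]

theorem mdifferentiableAt_extend_symm {e : OpenPartialHomeomorph M H} (he : e ∈ atlas H M)
    {y : E} (hy : y ∈ (e.extend J).target) :
    MDifferentiableAt 𝓘(ℝ, E) J (e.extend J).symm y :=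
  ((contMDiffOn_extend_symm_target he).contMDiffAt
    (e.isOpen_extend_target.mem_nhds hy)).mdifferentiableAt (by simp)

/-- Differentiate both composites of the chart with its inverse; each is the identity near the
point. -/
theorem isInvertible_mfderiv_extend_symm {e : OpenPartialHomeomorph M H} (he : e ∈ atlas H M)
    {y : E} (hy : y ∈ (e.extend J).target) :
    (mfderiv 𝓘(ℝ, E) J (e.extend J).symm y).IsInvertible := by
  have h1 := mdifferentiableAt_extend_symm he hy
  have hx : (e.extend J).symm y ∈ e.source := by
    simpa using (e.extend J).map_target hy
  have h2 : MDifferentiableAt J 𝓘(ℝ, E) (e.extend J) ((e.extend J).symm y) :=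
    (e.contMDiffAt_extend (n := ∞) (StructureGroupoid.subset_maximalAtlas _ he)
      hx).mdifferentiableAt (by simp)
  have hr : e.extend J ((e.extend J).symm y) = y := (e.extend J).right_inv hy
  have h1' : MDifferentiableAt 𝓘(ℝ, E) J (e.extend J).symm
      (e.extend J ((e.extend J).symm y)) := by rwa [hr]
  have hA : (mfderiv J 𝓘(ℝ, E) (e.extend J) ((e.extend J).symm y)).comp
      (mfderiv 𝓘(ℝ, E) J (e.extend J).symm y) = ContinuousLinearMap.id ℝ E := by
    rw [← mfderiv_comp y h2 h1]
    have : e.extend J ∘ (e.extend J).symm =ᶠ[nhds y] id := by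
      filter_upwards [e.isOpen_extend_target.mem_nhds hy] with z hz
      exact (e.extend J).right_inv hz
    rw [this.mfderiv_eq, mfderiv_id]
    rfl
  have hB : (mfderiv 𝓘(ℝ, E) J (e.extend J).symm y).comp
      (mfderiv J 𝓘(ℝ, E) (e.extend J) ((e.extend J).symm y)) =
        ContinuousLinearMap.id ℝ (TangentSpace J ((e.extend J).symm y)) := by
    have h := mfderiv_comp ((e.extend J).symm y) h1' h2
    have : (e.extend J).symm ∘ e.extend J =ᶠ[nhds ((e.extend J).symm y)] id := by
      filter_upwards [e.open_source.mem_nhds hx] with z hz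
      exact (e.extend J).left_inv (by simpa using hz)
    rw [this.mfderiv_eq, mfderiv_id] at h
    rw [hr] at h
    exact h.symm
  exact ContinuousLinearMap.IsInvertible.of_inverse hB hA

theorem contMDiffOn_mfderiv_extend_symm {e : OpenPartialHomeomorph M H} (he : e ∈ atlas H M)
    (u : E) : ContMDiffOn 𝓘(ℝ, E) J.tangent ∞
      (fun z ↦ (⟨(e.extend J).symm z, mfderiv 𝓘(ℝ, E) J (e.extend J).symm z u⟩ :
        TangentBundle J M)) (e.extend J).target := by
  have ho : IsOpen (e.extend J).target := e.isOpen_extend_target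
  have h1 := (contMDiffOn_extend_symm_target (J := J) he).contMDiffOn_tangentMapWithin
    (m := ∞) (by simp) ho.uniqueMDiffOn
  have h2 : ContMDiff 𝓘(ℝ, E) 𝓘(ℝ, E).tangent ∞
      (fun z : E ↦ (⟨z, u⟩ : TangentBundle 𝓘(ℝ, E) E)) := fun z ↦
    contMDiffAt_vectorSpace_iff_contDiffAt.2 contDiffAt_const
  refine (h1.comp h2.contMDiffOn fun z hz ↦ hz).congr fun z hz ↦ ?_
  simp only [Function.comp_apply, tangentMapWithin]
  rw [mfderivWithin_of_isOpen ho hz]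

/-- The metric is a smooth section of a bundle of bilinear forms, evaluated on the smooth images of
constant fields under the inverse chart. -/
theorem contDiffOn_chartMetric [FiniteDimensional ℝ E] {g : BilinField J M}
    (hg : IsPseudoRiemannian J g) {e : OpenPartialHomeomorph M H} (he : e ∈ atlas H M) :
    ContDiffOn ℝ ∞ (chartMetric J g e) (e.extend J).target := by
  rw [contDiffOn_clm_apply]
  intro u
  rw [contDiffOn_clm_apply]
  intro v
  simp only [chartMetric_apply]
  rw [← contMDiffOn_iff_contDiffOn]
  intro y hy
  have hb := contMDiffOn_extend_symm_target (J := J) he y hy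
  have key : ContMDiffWithinAt 𝓘(ℝ, E) (J.prod 𝓘(ℝ)) ∞
      (fun z ↦ Bundle.TotalSpace.mk' ℝ (E := Bundle.Trivial M ℝ) ((e.extend J).symm z)
        (g ((e.extend J).symm z) (mfderiv 𝓘(ℝ, E) J (e.extend J).symm z u)
          (mfderiv 𝓘(ℝ, E) J (e.extend J).symm z v))) (e.extend J).target y := by
    apply ContMDiffWithinAt.clm_bundle_apply₂ (F₁ := E) (F₂ := E)
    · exact hg.contMDiff.contMDiffAt.comp_contMDiffWithinAt y hb
    · exact contMDiffOn_mfderiv_extend_symm he u y hy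
    · exact contMDiffOn_mfderiv_extend_symm he v y hy
  exact (Bundle.contMDiffWithinAt_totalSpace.1 key).2

theorem chartMetric_nondegenerate {g : BilinField J M} (hg : IsPseudoRiemannian J g)
    {e : OpenPartialHomeomorph M H} (he : e ∈ atlas H M) {y : E} (hy : y ∈ (e.extend J).target)
    (v : E) (hv : ∀ w, chartMetric J g e y v w = 0) : v = 0 := by
  have hinv := isInvertible_mfderiv_extend_symm (J := J) he hy
  refine hinv.injective (a₁ := v) (a₂ := (0 : E))
    (Eq.trans ?_ (ContinuousLinearMap.map_zero _).symm)
  refine hg.nondegenerate _ _ fun w ↦ ?_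
  obtain ⟨w', rfl⟩ := hinv.surjective w
  exact hv w'

/-- A nondegenerate form on a nonzero space takes a nonzero value. This is what makes the Einstein
constant of the fibre independent of time. -/
theorem IsEinstein.eq_of_isPseudoRiemannian [Nonempty M] [Nontrivial E]
    {g : BilinField J M} (hg : IsPseudoRiemannian J g) {C : ConnCoeffs (E := E) (H := H) M} {α β : ℝ}
    (hα : IsEinstein J g C α) (hβ : IsEinstein J g C β) : α = β := by
  obtain ⟨p⟩ := ‹Nonempty M›
  have he := chart_mem_atlas H p
  have hx := mem_extChartAt_target (I := J) p
  obtain ⟨v, hv⟩ := exists_ne (0 : E)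
  by_contra hne
  refine hv (chartMetric_nondegenerate hg he hx v fun w ↦ ?_)
  have h1 := (hα _ he _ hx v w).symm.trans (hβ _ he _ hx v w)
  exact (mul_eq_mul_right_iff.1 h1).resolve_left hne

end Charts

/-! ### Charts of the product and the warped metric in them -/

section ProductCharts

variable {E : Type*} [NormedAddCommGroup E] [NormedSpace ℝ E] {H : Type*} [TopologicalSpace H]
  {J : ModelWithCorners ℝ E H} {F : Type*} [TopologicalSpace F] {I : TopologicalSpace.Opens ℝ}

theorem target_of_mem_atlas_opens {e : OpenPartialHomeomorph I ℝ} (he : e ∈ atlas ℝ I) :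
    e.target = I := by
  rcases isEmpty_or_nonempty I with hI | hI
  · have h1 : (I : Set ℝ) = ∅ := Set.isEmpty_coe_sort.1 hI
    rw [h1, ← Set.subset_empty_iff]
    intro t ht
    exact hI.elim (e.symm t)
  · obtain ⟨x, rfl⟩ := TopologicalSpace.Opens.chart_eq hI he
    rw [← OpenPartialHomeomorph.image_source_eq_target,
      OpenPartialHomeomorph.subtypeRestr_source, OpenPartialHomeomorph.subtypeRestr_coe]
    simp [chartAt_self_eq, Set.domRestrict]

/-- Charts of `I` are restrictions of the identity, so the time coordinate is `t` itself and `f`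
needs no reparametrisation. -/
theorem symm_of_mem_atlas_opens {e : OpenPartialHomeomorph I ℝ} (he : e ∈ atlas ℝ I) {t : ℝ}
    (ht : t ∈ I) : (e.symm t : ℝ) = t := by
  have hI : Nonempty I := ⟨⟨t, ht⟩⟩
  have ht' : t ∈ e.target := by rw [target_of_mem_atlas_opens he]; exact ht
  obtain ⟨x, rfl⟩ := TopologicalSpace.Opens.chart_eq hI he
  have := OpenPartialHomeomorph.subtypeRestr_symm_apply (chartAt ℝ (x : ℝ)) hI ht'
  simpa [chartAt_self_eq] using this

variable {e₁ : OpenPartialHomeomorph I ℝ} {e₂ : OpenPartialHomeomorph F H}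

theorem extend_prod_target (he₁ : e₁ ∈ atlas ℝ I) :
    ((e₁.prod e₂).extend (𝓘(ℝ, ℝ).prod J)).target = (I : Set ℝ) ×ˢ (e₂.extend J).target := by
  rw [OpenPartialHomeomorph.extend_prod]
  simp [target_of_mem_atlas_opens he₁]

theorem extend_prod_symm_fst (he₁ : e₁ ∈ atlas ℝ I) {y : ℝ × E} (hy : y.1 ∈ I) :
    ((((e₁.prod e₂).extend (𝓘(ℝ, ℝ).prod J)).symm y).1 : ℝ) = y.1 := by
  rw [OpenPartialHomeomorph.extend_prod]
  simpa using symm_of_mem_atlas_opens he₁ hy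

theorem extend_prod_symm_snd (y : ℝ × E) :
    (((e₁.prod e₂).extend (𝓘(ℝ, ℝ).prod J)).symm y).2 = (e₂.extend J).symm y.2 := by
  rw [OpenPartialHomeomorph.extend_prod]
  rfl

variable [ChartedSpace H F]

theorem dprojF_apply (p : I × F) (v : ℝ × E) : dprojF J I p v = v.2 := by
  rw [dprojF, mfderiv_snd]
  rfl

variable [IsManifold J ∞ F] [J.Boundaryless]

theorem dt_mfderiv_extend_prod_symm (he₁ : e₁ ∈ atlas ℝ I) (he₂ : e₂ ∈ atlas H F) {y : ℝ × E}
    (hy : y ∈ (I : Set ℝ) ×ˢ (e₂.extend J).target) (v : ℝ × E) :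
    dt J I _ (mfderiv 𝓘(ℝ, ℝ × E) (𝓘(ℝ, ℝ).prod J)
      ((e₁.prod e₂).extend (𝓘(ℝ, ℝ).prod J)).symm y v) = v.1 := by
  have hy' : y ∈ ((e₁.prod e₂).extend (𝓘(ℝ, ℝ).prod J)).target := by
    rwa [extend_prod_target he₁]
  have hmem : e₁.prod e₂ ∈ atlas (ModelProd ℝ H) (I × F) :=
    Set.mem_image2_of_mem he₁ he₂
  have h1 := mdifferentiableAt_extend_symm (J := 𝓘(ℝ, ℝ).prod J) hmem hy'
  have h2 : MDifferentiableAt (𝓘(ℝ, ℝ).prod J) 𝓘(ℝ, ℝ) (fun q : I × F ↦ (q.1 : ℝ))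
      (((e₁.prod e₂).extend (𝓘(ℝ, ℝ).prod J)).symm y) :=
    ((contMDiff_subtype_val (n := ∞)).comp contMDiff_fst).mdifferentiableAt (by simp)
  have h3 := mfderiv_comp y h2 h1
  have h4 : (fun q : I × F ↦ (q.1 : ℝ)) ∘ ((e₁.prod e₂).extend (𝓘(ℝ, ℝ).prod J)).symm
      =ᶠ[nhds y] Prod.fst := by
    filter_upwards [(I.2.preimage continuous_fst).mem_nhds hy.1] with z hz
    exact extend_prod_symm_fst he₁ hz
  rw [h4.mfderiv_eq, mfderiv_eq_fderiv] at h3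
  have h5 : fderiv ℝ (Prod.fst : ℝ × E → ℝ) y v = v.1 := by
    rw [fderiv_fst]
    rfl
  rw [← h5]
  exact (DFunLike.congr_fun h3 v).symm

theorem dprojF_mfderiv_extend_prod_symm (he₁ : e₁ ∈ atlas ℝ I) (he₂ : e₂ ∈ atlas H F)
    {y : ℝ × E} (hy : y ∈ (I : Set ℝ) ×ˢ (e₂.extend J).target) (v : ℝ × E) :
    dprojF J I _ (mfderiv 𝓘(ℝ, ℝ × E) (𝓘(ℝ, ℝ).prod J)
      ((e₁.prod e₂).extend (𝓘(ℝ, ℝ).prod J)).symm y v) =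
    mfderiv 𝓘(ℝ, E) J (e₂.extend J).symm y.2 v.2 := by
  have hy' : y ∈ ((e₁.prod e₂).extend (𝓘(ℝ, ℝ).prod J)).target := by
    rwa [extend_prod_target he₁]
  have hmem : e₁.prod e₂ ∈ atlas (ModelProd ℝ H) (I × F) :=
    Set.mem_image2_of_mem he₁ he₂
  have h1 := mdifferentiableAt_extend_symm (J := 𝓘(ℝ, ℝ).prod J) hmem hy'
  have h3 := mfderiv_comp y (mdifferentiableAt_snd (I := 𝓘(ℝ, ℝ)) (I' := J)
    (x := ((e₁.prod e₂).extend (𝓘(ℝ, ℝ).prod J)).symm y)) h1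
  have h4 : Prod.snd ∘ ((e₁.prod e₂).extend (𝓘(ℝ, ℝ).prod J)).symm =
      (e₂.extend J).symm ∘ (Prod.snd : ℝ × E → E) := by
    funext z
    exact extend_prod_symm_snd z
  have h5 : MDifferentiableAt 𝓘(ℝ, ℝ × E) 𝓘(ℝ, E) (Prod.snd : ℝ × E → E) y :=
    differentiableAt_snd.mdifferentiableAt
  rw [h4, mfderiv_comp y (mdifferentiableAt_extend_symm he₂ hy.2) h5, mfderiv_eq_fderiv,
    fderiv_snd] at h3
  exact (DFunLike.congr_fun h3 v).symm

theorem chartMetric_warpedMetric (gF : BilinField J F) (f : ℝ → ℝ) (he₁ : e₁ ∈ atlas ℝ I)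
    (he₂ : e₂ ∈ atlas H F) {y : ℝ × E} (hy : y ∈ (I : Set ℝ) ×ˢ (e₂.extend J).target) :
    chartMetric (𝓘(ℝ, ℝ).prod J) (warpedMetric J I f gF) (e₁.prod e₂) y =
      warpedForm f (chartMetric J gF e₂) y := by
  refine ContinuousLinearMap.ext fun u ↦ ContinuousLinearMap.ext fun v ↦ ?_
  rw [chartMetric_apply, warpedMetric_apply, warpedForm_apply, chartMetric_apply,
    dt_mfderiv_extend_prod_symm he₁ he₂ hy, dt_mfderiv_extend_prod_symm he₁ he₂ hy,
    dprojF_mfderiv_extend_prod_symm he₁ he₂ hy, dprojF_mfderiv_extend_prod_symm he₁ he₂ hy,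
    extend_prod_symm_fst he₁ hy.1, extend_prod_symm_snd]

/-- The derivative of the inverse chart is invertible, so it suffices that it sends `(1, 0)` to
`∂/∂t`; this is tested with `dt` and `dprojF`. -/
theorem mpullback_partialT (he₁ : e₁ ∈ atlas ℝ I) (he₂ : e₂ ∈ atlas H F) {y : ℝ × E}
    (hy : y ∈ (I : Set ℝ) ×ˢ (e₂.extend J).target) :
    VectorField.mpullback 𝓘(ℝ, ℝ × E) (𝓘(ℝ, ℝ).prod J)
      ((e₁.prod e₂).extend (𝓘(ℝ, ℝ).prod J)).symm (partialT J I) y = ((1 : ℝ), (0 : E)) := by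
  have hy' : y ∈ ((e₁.prod e₂).extend (𝓘(ℝ, ℝ).prod J)).target := by
    rwa [extend_prod_target he₁]
  have hmem : e₁.prod e₂ ∈ atlas (ModelProd ℝ H) (I × F) :=
    Set.mem_image2_of_mem he₁ he₂
  have hinv := isInvertible_mfderiv_extend_symm (J := 𝓘(ℝ, ℝ).prod J) hmem hy'
  rw [VectorField.mpullback]
  refine (hinv.inverse_apply_eq).2 ?_
  refine Prod.ext (α := ℝ) (β := E) ?_ ?_
  · have h := dt_mfderiv_extend_prod_symm he₁ he₂ hy ((1 : ℝ), (0 : E))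
    rw [dt_apply] at h
    exact h.symm
  · have h := dprojF_mfderiv_extend_prod_symm he₁ he₂ hy ((1 : ℝ), (0 : E))
    refine Eq.trans ?_ (Eq.trans h.symm (dprojF_apply _ _))
    exact (ContinuousLinearMap.map_zero _).symm

end ProductCharts

/-! ### The Einstein condition as scalar equations plus an Einstein fibre -/

section Einstein

variable {E : Type*} [NormedAddCommGroup E] [NormedSpace ℝ E] [FiniteDimensional ℝ E]

/-- The Einstein constant forced on the fibre at time `t`. -/
def fiberConstant (n a b α : ℝ) (f : ℝ → ℝ) (t : ℝ) : ℝ :=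
  α * f t ^ 2 + f t * deriv (deriv f) t + (n - 1) * deriv f t ^ 2 +
    ((1 - n) * b - n * a) * (f t * deriv f t) - b * (b - n * a) * f t ^ 2

theorem IsWarpedData.ricci_eq {f : ℝ → ℝ} {h : E → E →L[ℝ] E →L[ℝ] ℝ} {s : Set ℝ} {U : Set E}
    (hw : IsWarpedData f h s U) {y : ℝ × E} (hy : y ∈ s ×ˢ U) (a b α : ℝ) (u v : ℝ × E) :
    ricci (quarterSymmCoeff (warpedForm f h) (fun _ ↦ (1, 0)) a b) y u v -
        α * warpedForm f h y u v =
      ricci (christoffel h) y.2 u.2 v.2 -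
        fiberConstant (Module.finrank ℝ E) a b α f y.1 * h y.2 u.2 v.2 +
      (α - Module.finrank ℝ E * (a ^ 2 - a * b + b * (deriv f y.1 / f y.1) -
        deriv (deriv f) y.1 / f y.1)) * (u.1 * v.1) := by
  have h1 := hw.hasDerivAt hy.1
  have h2 := hw.hasDerivAt_deriv hy.1
  have hf := (hw.pos y.1 hy.1).ne'
  have hS := (h1.mul h2).sub ((h1.pow 2).const_mul b)
  have hH := h2.div h1 hf
  rw [hw.ricci_coeff hy a b rfl rfl hS hH, warpedForm_apply, fiberConstant]
  field_simp
  simp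
  ring

/-- The defect `Ric - α g` has a time part and a fibre part only. Evaluating at `(1, 0)` twice
isolates the first, at `(0, u)` and `(0, v)` the second. -/
theorem IsWarpedData.einstein_iff {f : ℝ → ℝ} {h : E → E →L[ℝ] E →L[ℝ] ℝ} {s : Set ℝ}
    {U : Set E} (hw : IsWarpedData f h s U) {y : ℝ × E} (hy : y ∈ s ×ˢ U) (a b α : ℝ) :
    (∀ u v, ricci (quarterSymmCoeff (warpedForm f h) (fun _ ↦ (1, 0)) a b) y u v =
        α * warpedForm f h y u v) ↔
      (α * f y.1 = Module.finrank ℝ E *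
        ((a ^ 2 - a * b) * f y.1 + b * deriv f y.1 - deriv (deriv f) y.1)) ∧
      ∀ u v, ricci (christoffel h) y.2 u v =
        fiberConstant (Module.finrank ℝ E) a b α f y.1 * h y.2 u v := by
  have hf := (hw.pos y.1 hy.1).ne'
  have key := hw.ricci_eq hy a b α
  constructor
  · intro hE
    constructor
    · have h0 : ricci (christoffel h) y.2 0 0 = 0 := by
        have h1 : curvature (christoffel h) y.2 0 0 = 0 := by
          ext w
          simp [curvature_apply]
        simp [ricci, h1]
      have h1 := key (1, 0) (1, 0)
      simp only [hE, sub_self, h0, map_zero, mul_zero, zero_add, mul_one] at h1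
      field_simp at h1
      linear_combination -h1
    · intro u v
      have h1 := key (0, u) (0, v)
      simp only [hE, sub_self, mul_zero, add_zero] at h1
      linear_combination -h1
  · rintro ⟨h1, h2⟩ u v
    have h3 := key u v
    have h4 : α - Module.finrank ℝ E * (a ^ 2 - a * b + b * (deriv f y.1 / f y.1) -
        deriv (deriv f) y.1 / f y.1) = 0 := by
      field_simp
      linear_combination h1
    rw [h2, h4] at h3
    linear_combination h3

variable {H : Type*} [TopologicalSpace H] {J : ModelWithCorners ℝ E H} {F : Type*}
  [TopologicalSpace F] [ChartedSpace H F] [IsManifold J ∞ F] [J.Boundaryless]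
  {I : TopologicalSpace.Opens ℝ} {gF : BilinField J F} {f : ℝ → ℝ}

theorem isWarpedData_chartMetric (hgF : IsPseudoRiemannian J gF) (hf : ContDiffOn ℝ ∞ f I)
    (hf₀ : ∀ t ∈ I, 0 < f t) {e : OpenPartialHomeomorph F H} (he : e ∈ atlas H F) :
    IsWarpedData f (chartMetric J gF e) I (e.extend J).target where
  isOpen_time := I.2
  isOpen_space := e.isOpen_extend_target
  smooth_fun := hf
  pos := hf₀
  smooth_form := contDiffOn_chartMetric hgF he
  symm := fun y _ ↦ chartMetric_symm hgF e y
  nondegenerate := fun _ hy ↦ chartMetric_nondegenerate hgF he hy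

theorem isEinstein_warpedMetric_iff [Nonempty F] (hgF : IsPseudoRiemannian J gF)
    (hf : ContDiffOn ℝ ∞ f I) (hf₀ : ∀ t ∈ I, 0 < f t) (a b α : ℝ) :
    IsEinstein (𝓘(ℝ, ℝ).prod J) (warpedMetric J I f gF)
        (quarterSymm (𝓘(ℝ, ℝ).prod J) (warpedMetric J I f gF) (partialT J I) a b) α ↔
      ∀ t ∈ I, (α * f t = Module.finrank ℝ E *
          ((a ^ 2 - a * b) * f t + b * deriv f t - deriv (deriv f) t)) ∧
        IsEinstein J gF (leviCivita J gF) (fiberConstant (Module.finrank ℝ E) a b α f t) := by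
  have key : ∀ e₁ ∈ atlas ℝ I, ∀ e₂ ∈ atlas H F, ∀ y ∈ (I : Set ℝ) ×ˢ (e₂.extend J).target,
      (∀ u v, ricci (quarterSymm (𝓘(ℝ, ℝ).prod J) (warpedMetric J I f gF) (partialT J I) a b
          (e₁.prod e₂)) y u v =
        α * chartMetric (𝓘(ℝ, ℝ).prod J) (warpedMetric J I f gF) (e₁.prod e₂) y u v) ↔
      (α * f y.1 = Module.finrank ℝ E *
        ((a ^ 2 - a * b) * f y.1 + b * deriv f y.1 - deriv (deriv f) y.1)) ∧
      ∀ u v, ricci (leviCivita J gF e₂) y.2 u v =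
        fiberConstant (Module.finrank ℝ E) a b α f y.1 * chartMetric J gF e₂ y.2 u v := by
    intro e₁ he₁ e₂ he₂ y hy
    have hw := isWarpedData_chartMetric hgF hf hf₀ he₂
    have h1 : Set.EqOn (VectorField.mpullback 𝓘(ℝ, ℝ × E) (𝓘(ℝ, ℝ).prod J)
        ((e₁.prod e₂).extend (𝓘(ℝ, ℝ).prod J)).symm (partialT J I))
        (fun _ ↦ ((1 : ℝ), (0 : E))) ((I : Set ℝ) ×ˢ (e₂.extend J).target) :=
      fun z hz ↦ mpullback_partialT he₁ he₂ hz
    have h2 : Set.EqOn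
        (chartMetric (𝓘(ℝ, ℝ).prod J) (warpedMetric J I f gF) (e₁.prod e₂))
        (warpedForm f (chartMetric J gF e₂)) ((I : Set ℝ) ×ˢ (e₂.extend J).target) :=
      fun z hz ↦ chartMetric_warpedMetric gF f he₁ he₂ hz
    rw [leviCivita, ← hw.einstein_iff hy a b α]
    refine forall_congr' fun u ↦ forall_congr' fun v ↦ ?_
    rw [quarterSymm, ricci_quarterSymmCoeff_congr hw.isOpen_prod h2 h1 a b hy u v, h2 hy]
  constructor
  · intro hE t ht
    have hE' : ∀ e₂ ∈ atlas H F, ∀ x ∈ (e₂.extend J).target, _ := fun e₂ he₂ x hx ↦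
      (key _ (chart_mem_atlas ℝ (⟨t, ht⟩ : I)) e₂ he₂ (t, x) ⟨ht, hx⟩).1
        (hE _ (Set.mem_image2_of_mem (chart_mem_atlas ℝ (⟨t, ht⟩ : I)) he₂) (t, x) (by
          rw [extend_prod_target (chart_mem_atlas ℝ (⟨t, ht⟩ : I))]
          exact ⟨ht, hx⟩))
    -- The time equation does not involve the fibre, but reading it off requires some point of the
    -- fibre.
    obtain ⟨p⟩ := ‹Nonempty F›
    exact ⟨(hE' _ (chart_mem_atlas H p) _ (mem_extChartAt_target p)).1,
      fun e he x hx ↦ (hE' e he x hx).2⟩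
  · rintro h _ ⟨e₁, he₁, e₂, he₂, rfl⟩ y hy
    rw [extend_prod_target he₁] at hy
    exact (key e₁ he₁ e₂ he₂ y hy).2 ⟨(h y.1 hy.1).1, fun u v ↦ (h y.1 hy.1).2 e₂ he₂ y.2 hy.2 u v⟩

theorem isEinstein_warpedMetric_iff_exists [Nonempty F] [Nontrivial E]
    (hgF : IsPseudoRiemannian J gF) (hI : (I : Set ℝ).Nonempty)
    (hf : ContDiffOn ℝ ∞ f I) (hf₀ : ∀ t ∈ I, 0 < f t) (a b α : ℝ) :
    IsEinstein (𝓘(ℝ, ℝ).prod J) (warpedMetric J I f gF)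
        (quarterSymm (𝓘(ℝ, ℝ).prod J) (warpedMetric J I f gF) (partialT J I) a b) α ↔
      ∃ αF, IsEinstein J gF (leviCivita J gF) αF ∧
        ∀ t ∈ I, WarpingEquations (Module.finrank ℝ E) a b α αF f t := by
  rw [isEinstein_warpedMetric_iff hgF hf hf₀]
  constructor
  · intro h
    obtain ⟨t₀, ht₀⟩ := hI
    refine ⟨_, (h t₀ ht₀).2, fun t ht ↦ ⟨(h t ht).1, ?_⟩⟩
    rw [(h t₀ ht₀).2.eq_of_isPseudoRiemannian hgF (h t ht).2, fiberConstant]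
    -- Adding `f` times the time equation eliminates `α` from the fibre constant, which gives the
    -- form of the `space` equation.
    linear_combination f t * (h t ht).1
  · rintro ⟨αF, hF, h⟩ t ht
    refine ⟨(h t ht).time, ?_⟩
    convert hF using 1
    rw [(h t ht).space, fiberConstant]
    linear_combination f t * (h t ht).time

end Einstein

/-! ### Constants belonging to each warping function -/

section Classification

variable {s : Set ℝ} {f : ℝ → ℝ} {n a b α αF : ℝ}

/-- The warping equations along `f = c * exp (k * t) + d`, in terms of the value of `f`. -/
theorem warpingEquations_of_eq_mul_exp_add (hs : IsOpen s) {c d k : ℝ}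
    (hf : ∀ t ∈ s, f t = c * Real.exp (k * t) + d) {t : ℝ} (ht : t ∈ s) :
    WarpingEquations n a b α αF f t ↔
      α * f t = n * ((a ^ 2 - a * b) * f t + b * (k * (f t - d)) - k ^ 2 * (f t - d)) ∧
      αF = (1 - n) * (f t * (k ^ 2 * (f t - d)) - (k * (f t - d)) ^ 2) +
        (b - n * a) * (f t * (k * (f t - d))) + (n * a ^ 2 - b ^ 2) * f t ^ 2 := by
  obtain ⟨h1, h2⟩ := derivs_of_eq_mul_exp_add hs hf ht
  rw [← h1, ← h2]
  exact ⟨fun h ↦ ⟨h.time, h.space⟩, fun h ↦ ⟨h.1, h.2⟩⟩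

theorem warpingEquations_of_eq_mul_exp (hs : IsOpen s) {c k : ℝ}
    (hf : ∀ t ∈ s, f t = c * Real.exp (k * t)) (hpos : ∀ t ∈ s, 0 < f t) {t : ℝ} (ht : t ∈ s) :
    WarpingEquations n a b α αF f t ↔ α = n * (a ^ 2 - a * b + b * k - k ^ 2) ∧
      αF = ((b - n * a) * k + (n * a ^ 2 - b ^ 2)) * f t ^ 2 := by
  rw [warpingEquations_of_eq_mul_exp_add hs (d := 0) (c := c) (k := k) (by simpa using hf) ht,
    ← mul_left_inj' (hpos t ht).ne' (a := α)]
  refine and_congr ?_ ?_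
  · constructor <;> intro h <;> linear_combination h
  · constructor <;> intro h <;> linear_combination h

/-- The space equation reads `αF = Q f²` with `Q` constant. Its derivative is `0 = 2 k Q f²`, so `Q
= 0` and then `αF = 0`. -/
theorem warpingEquations_of_eq_exp_iff (hs : IsOpen s) (hne : s.Nonempty) {c k : ℝ} (hk : k ≠ 0)
    (hf : ∀ t ∈ s, f t = c * Real.exp (k * t)) (hpos : ∀ t ∈ s, 0 < f t) :
    (∀ t ∈ s, WarpingEquations n a b α αF f t) ↔
      α = n * (a ^ 2 - a * b + b * k - k ^ 2) ∧ αF = 0 ∧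
        (b - n * a) * k + (n * a ^ 2 - b ^ 2) = 0 := by
  constructor
  · intro h
    have h' := fun t ht ↦ (warpingEquations_of_eq_mul_exp hs hf hpos ht).1 (h t ht)
    obtain ⟨t, ht⟩ := hne
    set Q := (b - n * a) * k + (n * a ^ 2 - b ^ 2)
    have hd : HasDerivAt f (k * f t) t := by
      have h1 := (hasDerivAt_mul_exp_add c 0 k t).congr_of_eventuallyEq (f₁ := f) (by
        filter_upwards [hs.mem_nhds ht] with x hx
        simp [hf x hx])
      convert! h1 using 1
      rw [hf t ht]
      ring
    have h1 := ((hd.pow 2).const_mul Q).unique ((hasDerivAt_const t αF).congr_of_eventuallyEq (by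
      filter_upwards [hs.mem_nhds ht] with x hx
      simp [(h' x hx).2]))
    have hQ : Q = 0 := by
      have := (hpos t ht).ne'
      simpa [hk, this] using h1
    exact ⟨(h' t ht).1, by rw [(h' t ht).2, hQ, zero_mul], hQ⟩
  · rintro ⟨h1, h2, h3⟩ t ht
    rw [warpingEquations_of_eq_mul_exp hs hf hpos ht, h3, zero_mul]
    exact ⟨h1, h2⟩

theorem warpingEquations_of_eq_const (hs : IsOpen s) {c : ℝ} (hf : ∀ t ∈ s, f t = c)
    (hpos : ∀ t ∈ s, 0 < f t) {t : ℝ} (ht : t ∈ s) :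
    WarpingEquations n a b α αF f t ↔
      α = (a ^ 2 - a * b) * n ∧ αF = c ^ 2 * (n * a ^ 2 - b ^ 2) := by
  rw [warpingEquations_of_eq_mul_exp hs (c := c) (k := 0) (by simpa using hf) hpos ht, hf t ht]
  refine and_congr ?_ ?_ <;> constructor <;> intro h <;> linear_combination h

theorem forall_warpingEquations_iff (hs : IsOpen s) (hc : IsPreconnected s) (hne : s.Nonempty)
    (hn : 1 < n) (ha : a ≠ 0) (hb : b ≠ 0) (hpos : ∀ t ∈ s, 0 < f t)
    (hf : ContDiffOn ℝ ∞ f s) :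
    (∀ t ∈ s, WarpingEquations n a b α αF f t) ↔
      ((∃ c₂ : ℝ, α = (a ^ 2 - a * b) * n ∧ αF = c₂ ^ 2 * (n * a ^ 2 - b ^ 2) ∧
          ∀ t ∈ s, f t = c₂) ∨
       (∃ c₁ c₂ : ℝ, a = b ∧ α = 0 ∧ αF = (n - 1) * c₂ ^ 2 * a ^ 2 ∧
          ∀ t ∈ s, f t = c₁ * Real.exp (a * t) + c₂) ∨
       (∃ c₀ : ℝ, b ^ 2 - 2 * n * a ^ 2 + n * a * b ≠ 0 ∧ b ≠ n * a ∧
          α = ((3 * n ^ 2 + n) * a ^ 2 * b ^ 2 - (n ^ 2 + n) * a * b ^ 3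
              - 2 * n ^ 2 * a ^ 3 * b) / (n * a - b) ^ 2 ∧ αF = 0 ∧
          ∀ t ∈ s, f t = c₀ * Real.exp ((n * a ^ 2 - b ^ 2) * t / (n * a - b))) ∨
       (∃ c₁ : ℝ, b ^ 2 - 2 * n * a ^ 2 + n * a * b = 0 ∧ α = n * (a - b / 2) ^ 2 ∧ αF = 0 ∧
          ∀ t ∈ s, f t = c₁ * Real.exp (b / 2 * t))) := by
  have hd : ∀ t ∈ s, HasDerivAt f (deriv f t) t := fun t ht ↦
    ((hf.contDiffAt (hs.mem_nhds ht)).differentiableAt (by simp)).hasDerivAt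
  have hd' : ∀ t ∈ s, HasDerivAt (deriv f) (deriv (deriv f) t) t := fun t ht ↦
    (((hf.deriv_of_isOpen (m := ∞) hs (by simp)).contDiffAt
      (hs.mem_nhds ht)).differentiableAt (by simp)).hasDerivAt
  -- The equation `Q = 0` can be solved for `k`: if `b = n a`, it would become `n (n - 1) a² = 0`.
  have hne' : ∀ {k : ℝ}, (b - n * a) * k + (n * a ^ 2 - b ^ 2) = 0 → n * a - b ≠ 0 := by
    intro k hk h0
    have hb' : b = n * a := by linarith
    rw [hb'] at hk
    have h1 : n * (n - 1) * a ^ 2 = 0 := by linear_combination -hk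
    have h2 : n * (n - 1) ≠ 0 := mul_ne_zero (by linarith) (by linarith)
    exact mul_ne_zero h2 (pow_ne_zero 2 ha) h1
  constructor
  · intro h
    obtain ⟨t₀, ht₀⟩ := hne
    rcases exists_eq_of_warpingEquations hs hc ⟨t₀, ht₀⟩ hn ha hb hpos hd hd' h with
      ⟨c, hfc⟩ | ⟨rfl, hα, c, d, hfc⟩ | ⟨k, c, hk, hfc⟩
    · obtain ⟨h1, h2⟩ := (warpingEquations_of_eq_const hs hfc hpos ht₀).1 (h t₀ ht₀)
      exact Or.inl ⟨c, h1, h2, hfc⟩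
    · obtain ⟨-, h2⟩ := (warpingEquations_of_eq_mul_exp_add hs hfc ht₀).1 (h t₀ ht₀)
      refine Or.inr (Or.inl ⟨c, d, rfl, hα, ?_, hfc⟩)
      rw [h2]
      ring
    · obtain ⟨h1, h2, h3⟩ :=
        (warpingEquations_of_eq_exp_iff hs ⟨t₀, ht₀⟩ hk hfc hpos).1 h
      have h4 := hne' h3
      have hk' : k = (n * a ^ 2 - b ^ 2) / (n * a - b) := by
        rw [eq_div_iff h4]
        linear_combination -h3
      -- With `k = (n a² - b²) / (n a - b)`, the condition `hq` says `k = b/2`, the case where `k`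
      -- is a double root of the characteristic equation of `f'' = b f' + m f`.
      by_cases hq : b ^ 2 - 2 * n * a ^ 2 + n * a * b = 0
      · have hkb : k = b / 2 := by
          rw [hk', div_eq_iff h4]
          linear_combination -hq / 2
        refine Or.inr (Or.inr (Or.inr ⟨c, hq, ?_, h2, ?_⟩))
        · rw [h1, hkb]
          ring
        · rwa [← hkb]
      · refine Or.inr (Or.inr (Or.inl ⟨c, hq, fun hb' ↦ h4 (by rw [hb', sub_self]), ?_, h2, ?_⟩))
        · rw [h1, hk']
          field_simp
          ring
        · intro t ht
          rw [hfc t ht, hk', div_mul_eq_mul_div]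
  · rintro (⟨c, h1, h2, hfc⟩ | ⟨c, d, rfl, h1, h2, hfc⟩ | ⟨c, -, hna, h1, h2, hfc⟩ |
      ⟨c, hq, h1, h2, hfc⟩) t ht
    · exact (warpingEquations_of_eq_const hs hfc hpos ht).2 ⟨h1, h2⟩
    · rw [warpingEquations_of_eq_mul_exp_add hs hfc ht, h1, h2]
      constructor <;> ring
    · have h4 : n * a - b ≠ 0 := fun h0 ↦ hna (by linarith)
      rw [warpingEquations_of_eq_mul_exp hs (c := c) (k := (n * a ^ 2 - b ^ 2) / (n * a - b))
        (fun t ht ↦ by rw [hfc t ht, div_mul_eq_mul_div]) hpos ht, h1, h2]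
      constructor
      · field_simp
        ring
      · field_simp
        ring
    · rw [warpingEquations_of_eq_mul_exp hs hfc hpos ht, h1, h2]
      constructor
      · ring
      · linear_combination f t ^ 2 / 2 * hq

end Classification

end QuarterSym

end

open QuarterSym in
theorem theorem3p16 {l : ℕ} (hl : 1 < l)
    (I : TopologicalSpace.Opens ℝ) (hI : (I : Set ℝ).OrdConnected) (hI₀ : (I : Set ℝ).Nonempty)
    {F : Type*} [TopologicalSpace F] [ChartedSpace (EuclideanSpace ℝ (Fin l)) F]
    [IsManifold (𝓡 l) ∞ F] [Nonempty F]
    (gF : BilinField (𝓡 l) F) (hgF : IsPseudoRiemannian (𝓡 l) gF)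
    (f : ℝ → ℝ) (hf : ContDiffOn ℝ ∞ f I) (hf₀ : ∀ t ∈ I, 0 < f t)
    (lam₁ lam₂ : ℝ) (hlam₁ : lam₁ ≠ 0) (hlam₂ : lam₂ ≠ 0) (α : ℝ) :
    IsEinstein (𝓘(ℝ, ℝ).prod (𝓡 l)) (warpedMetric (𝓡 l) I f gF)
        (quarterSymm (𝓘(ℝ, ℝ).prod (𝓡 l)) (warpedMetric (𝓡 l) I f gF) (partialT (𝓡 l) I)
          lam₁ lam₂) α ↔
      ∃ αF : ℝ, IsEinstein (𝓡 l) gF (leviCivita (𝓡 l) gF) αF ∧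
        ((∃ c₂ : ℝ, α = (lam₁ ^ 2 - lam₁ * lam₂) * l ∧
            αF = c₂ ^ 2 * (l * lam₁ ^ 2 - lam₂ ^ 2) ∧ ∀ t ∈ I, f t = c₂) ∨
         (∃ c₁ c₂ : ℝ, lam₁ = lam₂ ∧ α = 0 ∧ αF = (l - 1) * c₂ ^ 2 * lam₁ ^ 2 ∧
            ∀ t ∈ I, f t = c₁ * Real.exp (lam₁ * t) + c₂) ∨
         (∃ c₀ : ℝ, lam₂ ^ 2 - 2 * l * lam₁ ^ 2 + l * lam₁ * lam₂ ≠ 0 ∧ lam₂ ≠ l * lam₁ ∧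
            α = ((3 * l ^ 2 + l) * lam₁ ^ 2 * lam₂ ^ 2 - (l ^ 2 + l) * lam₁ * lam₂ ^ 3
                - 2 * l ^ 2 * lam₁ ^ 3 * lam₂) / (l * lam₁ - lam₂) ^ 2 ∧ αF = 0 ∧
            ∀ t ∈ I, f t = c₀ * Real.exp ((l * lam₁ ^ 2 - lam₂ ^ 2) * t / (l * lam₁ - lam₂))) ∨
         (∃ c₁ : ℝ, lam₂ ^ 2 - 2 * l * lam₁ ^ 2 + l * lam₁ * lam₂ = 0 ∧
            α = l * (lam₁ - lam₂ / 2) ^ 2 ∧ αF = 0 ∧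
            ∀ t ∈ I, f t = c₁ * Real.exp (lam₂ / 2 * t))) := by
  have : Nontrivial (EuclideanSpace ℝ (Fin l)) :=
    Module.nontrivial_of_finrank_pos (R := ℝ) (by simp; omega)
  rw [isEinstein_warpedMetric_iff_exists hgF hI₀ hf hf₀]
  refine exists_congr fun αF ↦ and_congr_right fun _ ↦ ?_
  rw [finrank_euclideanSpace_fin]
  exact forall_warpingEquations_iff I.2 hI.isPreconnected hI₀ (by exact_mod_cast hl) hlam₁ hlam₂
    hf₀ hf
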